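/- **Proposition 2.4.** A *Gr-category* is a monoidal category $\mathbb G$ (unit object $I$, associativity, left and right unit constraints $\mathbf a,\mathbf l,\mathbf r$) in which every morphism is an isomorphism and every object is invertible for $\otimes$. A *Gr-functor* is a (strong) monoidal functor between Gr-categories; $\widetilde F_{X,Y}:FX\otimes FY\to F(X\otimes Y)$ denotes the structure isomorphisms of a Gr-functor $F$. For a Gr-category $\mathbb G$, let $\pi_0\mathbb G$ be the group of isomorphism classes of objects under $\otimes$, and $\pi_1\mathbb G=\mathrm{Aut}(I)$, an abelian group written additively. For $u\in\pi_1\mathbb G$ and an object $X$ put $\gamma_X(u)=\mathbf l_X(u\otimes \mathrm{id})\mathbf l_X^{-1}$ and $\delta_X(u)=\mathbf r_X(\mathrm{id}\otimes u)\mathbf r_X^{-1}$; $\gamma_X$ is a bijection $\pi_1\mathbb G\to\mathrm{Aut}(X)$, and $\pi_0\mathbb G$ acts on $\pi_1\mathbb G$ by $su=\gamma_X^{-1}\delta_X(u)$, $X\in s$. Choose for each $s\in\pi_0\mathbb G$ a representative $X_s\in s$, and for each $X\in s$ an isomorphism $i_X:X_s\to X$ with $i_{X_s}=\mathrm{id}$.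 The *reduction* $S_{\mathbb G}$ (for this choice) is the Gr-category whose objects are the elements of $\pi_0\mathbb G$, whose morphisms are the automorphisms $(s,u):s\to s$ with $u\in\pi_1\mathbb G$, with $(s,u)(s,v)=(s,u+v)$, $s\otimes t=st$, $(s,u)\otimes(t,v)=(st,u+sv)$, unit object $1=[I]$, and with the associativity and unit constraints transported from $\mathbb G$, i.e. the unique ones for which the fully faithful functor $H:S_{\mathbb G}\to\mathbb G$, $H(s)=X_s$, $H(s,u)=\gamma_{X_s}(u)$, is monoidal with $\widetilde H_{s,t}=i_{X_s\otimes X_t}^{-1}$ and unit isomorphism $i_I^{-1}:I\to X_1$. In the other direction there is the Gr-functor $G:\mathbb G\to S_{\mathbb G}$, $G(X)=[X]$, $G(f:X\to Y)=(s,\gamma_{X_s}^{-1}(i_Y^{-1}f\,i_X))$ with $s=[X]=[Y]$, $\widetilde G_{X,Y}=G(i_X\otimes i_Y)$, and the identity as unit isomorphism. $G$ and $H$ are equivalences, called the *canonical equivalences*. Let $F:\mathbb G\to\mathbb G'$ be a Gr-functor, and let reductions $S_{\mathbb G}$, $S_{\mathbb G'}$ be given, for arbitrary choices as above, with canonical equivalences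 $(G,H)$ and $(G',H')$. Define $F_0:\pi_0\mathbb G\to\pi_0\mathbb G'$, $[X]\mapsto[FX]$, and $F_1:\pi_1\mathbb G\to\pi_1\mathbb G'$, $u\mapsto\gamma_{FI}^{-1}(Fu)$. Then there is a Gr-functor $S_F:S_{\mathbb G}\to S_{\mathbb G'}$ of type $(F_0,F_1)$; that is, $F_0$ and $F_1$ are group homomorphisms with $F_1(su)=F_0(s)F_1(u)$, and $S_F(s)=F_0(s)$, $S_F(s,u)=(F_0(s),F_1(u))$ for all $s\in\pi_0\mathbb G$ and $u\in\pi_1\mathbb G$. Moreover $S_F=G'FH$ as Gr-functors, i.e. also with their monoidal structures. -/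

import Mathlib

open CategoryTheory MonoidalCategory

universe v₁ v₂ v₃ u₁ u₂ u₃

noncomputable section

namespace GrCat

/-- A Gr-category: a monoidal category in which every morphism is an isomorphism and every object
is invertible for the tensor product. -/
class GrCategory (C : Type u₁) [Category.{v₁} C] [MonoidalCategory C] : Prop
    extends IsGroupoid C where
  exists_inverse : ∀ X : C, ∃ Y : C, Nonempty (X ⊗ Y ≅ 𝟙_ C) ∧ Nonempty (Y ⊗ X ≅ 𝟙_ C)

section Invariants

/-- The set `π₀` of isomorphism classes of objects. -/
def Pi0 (C : Type u₁) [Category.{v₁} C] : Type u₁ := Quotient (isIsomorphicSetoid C)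

/-- The set `π₁` of automorphisms of the unit object, written additively. -/
def Pi1 (C : Type u₁) [Category.{v₁} C] [MonoidalCategory C] : Type v₁ := Additive (Aut (𝟙_ C))

variable {C : Type u₁} [Category.{v₁} C]

/-- The isomorphism class of an object. -/
def cls (X : C) : Pi0 C := Quotient.mk (isIsomorphicSetoid C) X

theorem cls_eq {X Y : C} (e : X ≅ Y) : cls X = cls Y := Quotient.sound ⟨e⟩

theorem exists_iso_of_cls_eq {X Y : C} (h : cls X = cls Y) : Nonempty (X ≅ Y) := Quotient.exact h

theorem Pi0.ind {p : Pi0 C → Prop} (h : ∀ X, p (cls X)) (s : Pi0 C) : p s := Quotient.ind h s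

variable [MonoidalCategory C]

/-- The product on `π₀` is induced by the tensor product. -/
instance : Mul (Pi0 C) where
  mul := Quotient.map₂ (fun X Y => X ⊗ Y) (by
    rintro _ _ ⟨e⟩ _ _ ⟨f⟩
    exact ⟨e ⊗ᵢ f⟩)

instance : One (Pi0 C) := ⟨cls (𝟙_ C)⟩

theorem cls_tensor (X Y : C) : cls (X ⊗ Y) = cls X * cls Y := rfl

theorem cls_unit : cls (𝟙_ C) = 1 := rfl

instance : Monoid (Pi0 C) where
  mul_assoc s t r := by
    induction s using Pi0.ind; induction t using Pi0.ind; induction r using Pi0.ind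
    exact cls_eq (α_ _ _ _)
  one_mul s := by
    induction s using Pi0.ind
    exact cls_eq (λ_ _)
  mul_one s := by
    induction s using Pi0.ind
    exact cls_eq (ρ_ _)

theorem Pi0.exists_left_inv [GrCategory C] (s : Pi0 C) : ∃ t : Pi0 C, t * s = 1 := by
  induction s using Pi0.ind with | _ X
  obtain ⟨Y, -, ⟨e⟩⟩ := GrCategory.exists_inverse X
  exact ⟨cls Y, cls_eq e⟩

instance [GrCategory C] : Group (Pi0 C) where
  inv s := (Pi0.exists_left_inv s).choose
  inv_mul_cancel s := (Pi0.exists_left_inv s).choose_spec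

/-- The underlying endomorphism of the unit object. -/
def Pi1.hom (u : Pi1 C) : 𝟙_ C ⟶ 𝟙_ C := (Additive.toMul u : Aut (𝟙_ C)).hom

/-- The element of `π₁` given by an endomorphism of the unit object. -/
def Pi1.ofHom [IsGroupoid C] (f : 𝟙_ C ⟶ 𝟙_ C) : Pi1 C :=
  Additive.ofMul (asIso f : Aut (𝟙_ C))

theorem Pi1.ext {u v : Pi1 C} (h : u.hom = v.hom) : u = v :=
  Additive.toMul.injective (Iso.ext h)

@[simp] theorem Pi1.hom_ofHom [IsGroupoid C] (f : 𝟙_ C ⟶ 𝟙_ C) : (Pi1.ofHom f).hom = f := rfl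

/-- The group structure on `π₁` is composition of automorphisms. -/
instance : AddGroup (Pi1 C) := inferInstanceAs (AddGroup (Additive (Aut (𝟙_ C))))

@[simp] theorem Pi1.hom_add (u v : Pi1 C) : (u + v).hom = v.hom ≫ u.hom := rfl

@[simp] theorem Pi1.hom_zero : (0 : Pi1 C).hom = 𝟙 _ := rfl

instance : AddCommGroup (Pi1 C) where
  add_comm u v := Pi1.ext (by
    have h := whisker_exchange u.hom v.hom
    have hr : ∀ f : 𝟙_ C ⟶ 𝟙_ C, f ▷ 𝟙_ C = (λ_ _).hom ≫ f ≫ (λ_ _).inv := by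
      intro f; rw [unitors_equal, unitors_inv_equal, ← rightUnitor_naturality_assoc]; simp
    have hl : ∀ f : 𝟙_ C ⟶ 𝟙_ C, 𝟙_ C ◁ f = (λ_ _).hom ≫ f ≫ (λ_ _).inv := by
      intro f; rw [← leftUnitor_naturality_assoc]; simp
    rw [hr, hl] at h
    simpa using h)

/-- `γ_X(u) : X ⟶ X` is determined by `γ_X(u) ∘ l_X = l_X ∘ (u ⊗ id)`. -/
def gammaFun (X : C) (u : Pi1 C) : X ⟶ X := (λ_ X).inv ≫ u.hom ▷ X ≫ (λ_ X).hom

/-- `δ_X(u) : X ⟶ X` is determined by `δ_X(u) ∘ r_X = r_X ∘ (id ⊗ u)`. -/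
def delta (X : C) (u : Pi1 C) : X ⟶ X := (ρ_ X).inv ≫ X ◁ u.hom ≫ (ρ_ X).hom

theorem gammaFun_unit (u : Pi1 C) : gammaFun (𝟙_ C) u = u.hom := by
  rw [gammaFun, unitors_equal, unitors_inv_equal, rightUnitor_naturality]; simp

theorem delta_unit (u : Pi1 C) : delta (𝟙_ C) u = u.hom := by
  rw [delta, ← unitors_equal, ← unitors_inv_equal, leftUnitor_naturality]; simp

theorem gammaFun_natural {X Y : C} (f : X ⟶ Y) (u : Pi1 C) :
    gammaFun X u ≫ f = f ≫ gammaFun Y u := by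
  simp only [gammaFun, Category.assoc]
  rw [← leftUnitor_naturality, ← whisker_exchange_assoc, leftUnitor_inv_naturality_assoc]

theorem gammaFun_conj {X Y : C} (e : X ≅ Y) (u : Pi1 C) :
    gammaFun Y u = e.inv ≫ gammaFun X u ≫ e.hom := by
  rw [gammaFun_natural, Iso.inv_hom_id_assoc]

theorem delta_natural {X Y : C} (f : X ⟶ Y) (u : Pi1 C) :
    delta X u ≫ f = f ≫ delta Y u := by
  simp only [delta, Category.assoc]
  rw [← rightUnitor_naturality, whisker_exchange_assoc, rightUnitor_inv_naturality_assoc]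

theorem gammaFun_whiskerRight (X Y : C) (u : Pi1 C) :
    gammaFun X u ▷ Y = gammaFun (X ⊗ Y) u := by
  simp [gammaFun]

theorem whiskerLeft_delta (X Y : C) (u : Pi1 C) :
    X ◁ delta Y u = delta (X ⊗ Y) u := by
  simp [delta]

theorem whiskerLeft_gammaFun (X Y : C) (u : Pi1 C) :
    X ◁ gammaFun Y u = delta X u ▷ Y := by
  simp [delta, gammaFun]

theorem gammaFun_add (X : C) (u v : Pi1 C) :
    gammaFun X (u + v) = gammaFun X v ≫ gammaFun X u := by
  simp [gammaFun]

theorem gammaFun_zero (X : C) : gammaFun X (0 : Pi1 C) = 𝟙 X := by simp [gammaFun]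

theorem delta_add (X : C) (u v : Pi1 C) : delta X (u + v) = delta X v ≫ delta X u := by
  simp [delta]

theorem delta_zero (X : C) : delta X (0 : Pi1 C) = 𝟙 X := by simp [delta]

variable [GrCategory C]

instance tensorRight_isEquivalence (X : C) : (tensorRight X).IsEquivalence := by
  obtain ⟨Y, ⟨e⟩, ⟨e'⟩⟩ := GrCategory.exists_inverse X
  have i1 : tensorRight X ⋙ tensorRight Y ≅ 𝟭 C :=
    (tensorRightTensor X Y).symm ≪≫ (tensoringRight C).mapIso e ≪≫ rightUnitorNatIso C
  have i2 : tensorRight Y ⋙ tensorRight X ≅ 𝟭 C :=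
    (tensorRightTensor Y X).symm ≪≫ (tensoringRight C).mapIso e' ≪≫ rightUnitorNatIso C
  exact (CategoryTheory.Equivalence.mk (tensorRight X) (tensorRight Y) i1.symm
    i2).isEquivalence_functor

theorem gammaFun_bijective (X : C) : Function.Bijective (gammaFun X) := by
  constructor
  · intro u v h
    apply Pi1.ext
    apply (tensorRight X).map_injective
    simpa [gammaFun] using h
  · intro f
    obtain ⟨u, hu⟩ := (tensorRight X).map_surjective ((λ_ X).hom ≫ f ≫ (λ_ X).inv)
    refine ⟨Pi1.ofHom u, ?_⟩
    dsimp at hu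
    simp [gammaFun, hu]

/-- `γ_X` as a bijection from `π₁` onto the (auto)morphisms of `X`. -/
def gamma (X : C) : Pi1 C ≃ (X ⟶ X) := Equiv.ofBijective (gammaFun X) (gammaFun_bijective X)

@[simp] theorem gamma_apply (X : C) (u : Pi1 C) : gamma X u = gammaFun X u := rfl

theorem gammaFun_symm (X : C) (f : X ⟶ X) : gammaFun X ((gamma X).symm f) = f :=
  (gamma X).apply_symm_apply f

/-- The action `su = γ_X⁻¹(δ_X(u))`, for any `X ∈ s`. -/
instance : SMul (Pi0 C) (Pi1 C) where
  smul s u := Quotient.lift (fun X => (gamma X).symm (delta X u)) (by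
    rintro X Y ⟨e⟩
    rw [Equiv.symm_apply_eq, gamma_apply]
    rw [← cancel_mono e.hom, delta_natural, gammaFun_natural, gammaFun_symm]) s

theorem cls_smul (X : C) (u : Pi1 C) : cls X • u = (gamma X).symm (delta X u) := rfl

theorem gammaFun_smul (X : C) (u : Pi1 C) : gammaFun X (cls X • u) = delta X u := by
  rw [cls_smul, gammaFun_symm]

/-- `π₁` is a module over the group `π₀`. -/
instance : DistribMulAction (Pi0 C) (Pi1 C) where
  one_smul u := (gamma (𝟙_ C)).injective (by
    rw [← cls_unit, gamma_apply, gammaFun_smul, gamma_apply, delta_unit, gammaFun_unit])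
  mul_smul s t u := by
    induction s using Pi0.ind with | _ X
    induction t using Pi0.ind with | _ Y
    apply (gamma (X ⊗ Y)).injective
    rw [gamma_apply, gamma_apply, ← cls_tensor, gammaFun_smul, ← gammaFun_whiskerRight,
      gammaFun_smul, ← whiskerLeft_gammaFun, gammaFun_smul, whiskerLeft_delta]
  smul_zero s := by
    induction s using Pi0.ind with | _ X
    apply (gamma X).injective
    rw [gamma_apply, gamma_apply, gammaFun_smul, delta_zero, gammaFun_zero]
  smul_add s u v := by
    induction s using Pi0.ind with | _ X
    apply (gamma X).injective
    rw [gamma_apply, gamma_apply, gammaFun_smul, delta_add, gammaFun_add, gammaFun_smul,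
      gammaFun_smul]

end Invariants

section Aux

variable {C : Type u₁} [Category.{v₁} C]

theorem auxEqToHom {X Y X₁ Y₁ : C} (f : X ⟶ Y) (h : Y = Y₁) (h₁ : X = X₁) (h₂ : X₁ = X)
    (h₃ : Y = Y₁) (c : Y ⟶ Y₁) (d : X ⟶ X₁) (a : X₁ ⟶ X) (b : Y ⟶ Y₁) (hc : c = eqToHom h)
    (hd : d = eqToHom h₁) (ha : a = eqToHom h₂) (hb : b = eqToHom h₃) :
    f ≫ c = d ≫ a ≫ f ≫ b := by
  subst h h₁ ha hb hc hd
  simp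

theorem auxConj {X Y X₁ Y₁ : C} (f : X ⟶ Y) (a : X₁ ≅ X) (b : Y₁ ≅ Y) :
    (a.hom ≫ f ≫ b.inv) ≫ b.hom = a.hom ≫ f := by simp

theorem comp_eqToHom_eqToHom_symm {X Y Z : C} (f : X ⟶ Y) (h : Y = Z) (h' : Z = Y) :
    (f ≫ eqToHom h) ≫ eqToHom h' = f := by
  subst h
  simp

variable [MonoidalCategory C]

theorem auxNaturalLeft {X Y Z X₁ Y₁ Z₁ P Q P₁ Q₁ : C} (f : X ⟶ Y)
    (a : X₁ ≅ X) (b : Y₁ ≅ Y) (c : Z₁ ≅ Z) (p : X₁ ⊗ Z₁ ≅ P) (q : Y₁ ⊗ Z₁ ≅ Q)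
    (p₁ : P₁ ≅ X ⊗ Z) (q₁ : Q₁ ≅ Y ⊗ Z) :
    (p.inv ≫ (a.hom ≫ f ≫ b.inv) ▷ Z₁ ≫ q.hom) ≫ q.inv ≫ (b.hom ⊗ₘ c.hom) ≫ q₁.inv =
      (p.inv ≫ (a.hom ⊗ₘ c.hom) ≫ p₁.inv) ≫ p₁.hom ≫ f ▷ Z ≫ q₁.inv := by
  simp [MonoidalCategory.tensorHom_def, whisker_exchange_assoc]

theorem auxNaturalRight {X Y Z X₁ Y₁ Z₁ P Q P₁ Q₁ : C} (f : X ⟶ Y)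
    (a : X₁ ≅ X) (b : Y₁ ≅ Y) (c : Z₁ ≅ Z) (p : Z₁ ⊗ X₁ ≅ P) (q : Z₁ ⊗ Y₁ ≅ Q)
    (p₁ : P₁ ≅ Z ⊗ X) (q₁ : Q₁ ≅ Z ⊗ Y) :
    (p.inv ≫ Z₁ ◁ (a.hom ≫ f ≫ b.inv) ≫ q.hom) ≫ q.inv ≫ (c.hom ⊗ₘ b.hom) ≫ q₁.inv =
      (p.inv ≫ (c.hom ⊗ₘ a.hom) ≫ p₁.inv) ≫ p₁.hom ≫ Z ◁ f ≫ q₁.inv := by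
  simp [MonoidalCategory.tensorHom_def', ← whisker_exchange_assoc]

theorem auxAssoc {X Y Z X₁ Y₁ Z₁ P Q L R : C}
    (a : X₁ ≅ X) (b : Y₁ ≅ Y) (c : Z₁ ≅ Z) (p : X₁ ⊗ Y₁ ≅ P) (q : Y₁ ⊗ Z₁ ≅ Q)
    (p₁ : P ≅ X ⊗ Y) (q₁ : Q ≅ Y ⊗ Z)
    (l : P ⊗ Z₁ ≅ L) (r : X₁ ⊗ Q ≅ R) (l₁ : L ≅ (X ⊗ Y) ⊗ Z) (r₁ : R ≅ X ⊗ (Y ⊗ Z)) :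
    (l.inv ≫ (p.inv ≫ (a.hom ⊗ₘ b.hom) ≫ p₁.inv) ▷ Z₁ ≫ l.hom) ≫
      (l.inv ≫ (p₁.hom ⊗ₘ c.hom) ≫ l₁.inv) ≫ l₁.hom ≫ (α_ X Y Z).hom ≫ r₁.inv =
    (l.inv ≫ p.inv ▷ Z₁ ≫ (α_ X₁ Y₁ Z₁).hom ≫ X₁ ◁ q.hom ≫ r.hom) ≫
      (r.inv ≫ X₁ ◁ (q.inv ≫ (b.hom ⊗ₘ c.hom) ≫ q₁.inv) ≫ r.hom) ≫
      r.inv ≫ (a.hom ⊗ₘ q₁.hom) ≫ r₁.inv := by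
  simp only [MonoidalCategory.tensorHom_def, comp_whiskerRight, whiskerLeft_comp, Category.assoc,
    Iso.hom_inv_id_assoc, inv_hom_whiskerRight_assoc, whiskerLeft_hom_inv_assoc,
    Iso.inv_hom_id_assoc]
  rw [whisker_exchange_assoc, whisker_exchange_assoc, whisker_exchange_assoc]
  simp

theorem auxLeftUnit {X X₁ P U : C} (a : X₁ ≅ X) (u : 𝟙_ C ≅ U) (p : U ⊗ X₁ ≅ P)
    (p₁ : P ≅ 𝟙_ C ⊗ X) (e : U ⟶ U) (he : e = 𝟙 U) :
    p.inv ≫ u.inv ▷ X₁ ≫ (λ_ X₁).hom =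
      (p.inv ≫ e ▷ X₁ ≫ p.hom) ≫ (p.inv ≫ (u.inv ⊗ₘ a.hom) ≫ p₁.inv) ≫
        p₁.hom ≫ (λ_ X).hom ≫ a.inv := by
  subst he
  simp [MonoidalCategory.tensorHom_def]

theorem auxRightUnit {X X₁ P U : C} (a : X₁ ≅ X) (u : 𝟙_ C ≅ U) (p : X₁ ⊗ U ≅ P)
    (p₁ : P ≅ X ⊗ 𝟙_ C) (e : U ⟶ U) (he : e = 𝟙 U) :
    p.inv ≫ X₁ ◁ u.inv ≫ (ρ_ X₁).hom =
      (p.inv ≫ X₁ ◁ e ≫ p.hom) ≫ (p.inv ≫ (a.hom ⊗ₘ u.inv) ≫ p₁.inv) ≫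
        p₁.hom ≫ (ρ_ X).hom ≫ a.inv := by
  subst he
  simp [MonoidalCategory.tensorHom_def']

end Aux

section Reduction

variable {C : Type u₁} [Category.{v₁} C] [MonoidalCategory C]

variable (C) in
/-- A choice of a representative `X_s` of each class `s` and of an isomorphism `i_X : X_s ≅ X` for
each `X ∈ s`, such that `i_{X_s}` is the identity. No normalization of the representatives at the
unit object is imposed (if `X_1 = I` and the `i` of `I ⊗ X_s` and `X_s ⊗ I` are inverse unit constraints,
then the unit constraints of the reduction below are identities). -/
structure Representatives where
  rep : Pi0 C → C
  cls_rep : ∀ s, cls (rep s) = s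
  i : ∀ X : C, rep (cls X) ≅ X
  i_rep : ∀ s, i (rep s) = eqToIso (congrArg rep (cls_rep s))

namespace Representatives

instance : Nonempty (Representatives C) := by
  classical
  let rep : Pi0 C → C := Quotient.out
  have hrep : ∀ s, cls (rep s) = s := fun s => Quotient.out_eq (s := isIsomorphicSetoid C) s
  refine ⟨⟨rep, hrep, fun X => if h : X = rep (cls X) then eqToIso h.symm else
    (exists_iso_of_cls_eq (hrep (cls X))).some, fun s => ?_⟩⟩
  rw [dif_pos (by rw [hrep])]

variable (σ : Representatives C)

/-- The isomorphism `i_X : X_s ≅ X`, for `X ∈ s`. -/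
def iso {X : C} {s : Pi0 C} (h : cls X = s) : σ.rep s ≅ X :=
  eqToIso (congrArg σ.rep h.symm) ≪≫ σ.i X

end Representatives

/-- The objects of the reduced Gr-category: the elements of `π₀`. -/
structure Reduction (σ : Representatives C) where
  toPi0 : Pi0 C

namespace Reduction

variable {σ : Representatives C}

/-- A morphism `s ⟶ t` exists only if `s = t`, and it is then a pair `(s, u)` with `u ∈ π₁`. -/
@[ext] structure Hom (s t : Reduction σ) where
  eq : s.toPi0 = t.toPi0
  val : Pi1 C

instance : Category (Reduction σ) where
  Hom s t := Hom s t
  id _ := ⟨rfl, 0⟩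
  comp f g := ⟨f.eq.trans g.eq, f.val + g.val⟩
  id_comp _ := Hom.ext (zero_add _)
  comp_id _ := Hom.ext (add_zero _)
  assoc _ _ _ := Hom.ext (add_assoc _ _ _)

theorem hom_ext {s t : Reduction σ} {f g : s ⟶ t} (h : f.val = g.val) : f = g := Hom.ext h

@[simp] theorem id_val (s : Reduction σ) : Hom.val (𝟙 s) = 0 := rfl

@[simp] theorem comp_val {s t r : Reduction σ} (f : s ⟶ t) (g : t ⟶ r) :
    Hom.val (f ≫ g) = f.val + g.val := rfl

instance : IsGroupoid (Reduction σ) where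
  all_isIso f := ⟨⟨⟨f.eq.symm, -f.val⟩, hom_ext (add_neg_cancel _), hom_ext (neg_add_cancel _)⟩⟩

variable (σ) in
/-- The functor `H : s ↦ X_s, (s, u) ↦ γ_{X_s}(u)`. -/
def functorH : Reduction σ ⥤ C where
  obj s := σ.rep s.toPi0
  map {s t} f := gammaFun (σ.rep s.toPi0) f.val ≫ eqToHom (congrArg σ.rep f.eq)
  map_id s := by simp [gammaFun_zero]
  map_comp {s t r} f g := by
    rw [comp_val, add_comm, gammaFun_add, Category.assoc, Category.assoc,
      ← Category.assoc (eqToHom _) (gammaFun _ _), ← gammaFun_natural, Category.assoc,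
      eqToHom_trans]

@[simp] theorem functorH_obj (s : Reduction σ) : (functorH σ).obj s = σ.rep s.toPi0 := rfl

theorem functorH_map {s t : Reduction σ} (f : s ⟶ t) :
    (functorH σ).map f =
      gammaFun (σ.rep s.toPi0) f.val ≫ eqToHom (congrArg σ.rep f.eq) := rfl

variable [GrCategory C]

variable (σ) in
/-- `H` is fully faithful. -/
def fullyFaithfulH : (functorH σ).FullyFaithful where
  preimage {s t} f :=
    have h : s.toPi0 = t.toPi0 := by
      have h := cls_eq (asIso f)
      simpa only [functorH_obj, σ.cls_rep] using h
    ⟨h, (gamma (σ.rep s.toPi0)).symm (f ≫ eqToHom (congrArg σ.rep h.symm))⟩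
  map_preimage {s t} f := by
    rw [functorH_map, gammaFun_symm]
    exact comp_eqToHom_eqToHom_symm (X := σ.rep s.toPi0) (Y := σ.rep t.toPi0) f _ _
  preimage_map {s t} f := by
    apply hom_ext
    rw [Equiv.symm_apply_eq, functorH_map]
    exact comp_eqToHom_eqToHom_symm (gammaFun (σ.rep s.toPi0) f.val) _ _

instance : (functorH σ).Faithful := (fullyFaithfulH σ).faithful

instance : (functorH σ).Full := (fullyFaithfulH σ).full

variable (σ) in
/-- The isomorphism `i⁻¹ : X_s ⊗ X_t ≅ X_{st}`. -/
def tensorIso (s t : Pi0 C) : σ.rep s ⊗ σ.rep t ≅ σ.rep (s * t) :=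
  (σ.iso (by rw [cls_tensor, σ.cls_rep, σ.cls_rep])).symm

variable (σ) in
/-- The isomorphism `i⁻¹ : I ≅ X_1`. -/
def unitIso : 𝟙_ C ≅ σ.rep 1 := (σ.iso cls_unit).symm

/-- The tensor product `s ⊗ t = st`, `(s, u) ⊗ (t, v) = (st, u + sv)`; the constraints are those of
`C` transported along `H` and the isomorphisms `i⁻¹`. -/
instance : MonoidalCategoryStruct (Reduction σ) where
  tensorObj s t := ⟨s.toPi0 * t.toPi0⟩
  tensorUnit := ⟨1⟩
  tensorHom {s _ _ _} f g := ⟨congrArg₂ (· * ·) f.eq g.eq, f.val + s.toPi0 • g.val⟩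
  whiskerLeft s {_ _} g := ⟨congrArg (s.toPi0 * ·) g.eq, s.toPi0 • g.val⟩
  whiskerRight {_ _} f t := ⟨congrArg (· * t.toPi0) f.eq, f.val⟩
  associator s t r := (fullyFaithfulH σ).preimageIso
    ((tensorIso σ (s.toPi0 * t.toPi0) r.toPi0).symm ≪≫
      whiskerRightIso (tensorIso σ s.toPi0 t.toPi0).symm (σ.rep r.toPi0) ≪≫
      α_ (σ.rep s.toPi0) (σ.rep t.toPi0) (σ.rep r.toPi0) ≪≫
      whiskerLeftIso (σ.rep s.toPi0) (tensorIso σ t.toPi0 r.toPi0) ≪≫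
      tensorIso σ s.toPi0 (t.toPi0 * r.toPi0))
  leftUnitor s := (fullyFaithfulH σ).preimageIso
    ((tensorIso σ 1 s.toPi0).symm ≪≫ whiskerRightIso (unitIso σ).symm (σ.rep s.toPi0) ≪≫
      λ_ (σ.rep s.toPi0))
  rightUnitor s := (fullyFaithfulH σ).preimageIso
    ((tensorIso σ s.toPi0 1).symm ≪≫ whiskerLeftIso (σ.rep s.toPi0) (unitIso σ).symm ≪≫
      ρ_ (σ.rep s.toPi0))

theorem gammaFun_cls_rep_smul (s : Pi0 C) (Y : C) (v : Pi1 C) :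
    gammaFun (σ.rep s ⊗ Y) (s • v) = σ.rep s ◁ gammaFun Y v := by
  have h : s • v = cls (σ.rep s) • v := by rw [σ.cls_rep]
  rw [h, ← gammaFun_whiskerRight, gammaFun_smul, whiskerLeft_gammaFun]

variable (σ) in
/-- `H` together with the isomorphisms `i⁻¹` preserves all the operations. -/
def inducingData : Monoidal.InducingFunctorData (functorH σ) where
  μIso s t := tensorIso σ s.toPi0 t.toPi0
  εIso := unitIso σ
  whiskerLeft_eq := by
    rintro ⟨s⟩ ⟨t⟩ ⟨t'⟩ ⟨e, v⟩
    dsimp only at e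
    subst e
    change gammaFun (σ.rep (s * t)) (s • v) ≫ eqToHom rfl = (tensorIso σ s t).inv ≫
      σ.rep s ◁ (gammaFun (σ.rep t) v ≫ eqToHom rfl) ≫ (tensorIso σ s t).hom
    rw [eqToHom_refl, eqToHom_refl, Category.comp_id, Category.comp_id,
      ← gammaFun_cls_rep_smul]
    exact gammaFun_conj (tensorIso σ s t) _
  whiskerRight_eq := by
    rintro ⟨s⟩ ⟨s'⟩ ⟨e, u⟩ ⟨t⟩
    dsimp only at e
    subst e
    change gammaFun (σ.rep (s * t)) u ≫ eqToHom rfl = (tensorIso σ s t).inv ≫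
      (gammaFun (σ.rep s) u ≫ eqToHom rfl) ▷ σ.rep t ≫ (tensorIso σ s t).hom
    rw [eqToHom_refl, eqToHom_refl, Category.comp_id, Category.comp_id, gammaFun_whiskerRight]
    exact gammaFun_conj (tensorIso σ s t) _
  tensorHom_eq := by
    rintro ⟨s⟩ ⟨s'⟩ ⟨t⟩ ⟨t'⟩ ⟨e, u⟩ ⟨e', v⟩
    dsimp only at e e'
    subst e
    subst e'
    change gammaFun (σ.rep (s * t)) (u + s • v) ≫ eqToHom rfl = (tensorIso σ s t).inv ≫
      ((gammaFun (σ.rep s) u ≫ eqToHom rfl) ⊗ₘ (gammaFun (σ.rep t) v ≫ eqToHom rfl)) ≫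
        (tensorIso σ s t).hom
    rw [eqToHom_refl, eqToHom_refl, eqToHom_refl, Category.comp_id, Category.comp_id,
      Category.comp_id, tensorHom_def', gammaFun_whiskerRight, ← gammaFun_cls_rep_smul, ← gammaFun_add]
    exact gammaFun_conj (tensorIso σ s t) _
  associator_eq s t r := by
    refine ((fullyFaithfulH σ).map_preimage _).trans ?_
    simp
    rfl
  leftUnitor_eq s := by
    refine ((fullyFaithfulH σ).map_preimage _).trans ?_
    simp
    rfl
  rightUnitor_eq s := by
    refine ((fullyFaithfulH σ).map_preimage _).trans ?_
    simp
    rfl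

instance : MonoidalCategory (Reduction σ) := Monoidal.induced (functorH σ) (inducingData σ)

instance : GrCategory (Reduction σ) where
  exists_inverse s := ⟨⟨s.toPi0⁻¹⟩,
    ⟨eqToIso (congrArg Reduction.mk (mul_inv_cancel s.toPi0))⟩,
    ⟨eqToIso (congrArg Reduction.mk (inv_mul_cancel s.toPi0))⟩⟩

instance : (functorH σ).Monoidal :=
  (Monoidal.fromInducedCoreMonoidal (functorH σ) (inducingData σ)).toMonoidal

theorem functorH_μ (s t : Reduction σ) :
    Functor.LaxMonoidal.μ (functorH σ) s t = (tensorIso σ s.toPi0 t.toPi0).hom := rfl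

/-- The action `(f : X ⟶ Y) ↦ (s, γ_{X_s}⁻¹(i_Y⁻¹ f i_X))` of `G` on morphisms, where
`s = [X] = [Y]`. -/
def mapG {X Y : C} (f : X ⟶ Y) : (⟨cls X⟩ : Reduction σ) ⟶ ⟨cls Y⟩ :=
  ⟨cls_eq (asIso f), (gamma (σ.rep (cls X))).symm
    ((σ.i X).hom ≫ f ≫ (σ.iso (cls_eq (asIso f)).symm).inv)⟩

theorem functorH_map_mapG {X Y : C} (f : X ⟶ Y) :
    (functorH σ).map (mapG f) = (σ.i X).hom ≫ f ≫ (σ.i Y).inv := by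
  refine (congrArg (· ≫ eqToHom _) (gammaFun_symm _ _)).trans ?_
  have h := comp_eqToHom_eqToHom_symm ((σ.i X).hom ≫ f ≫ (σ.i Y).inv)
    (congrArg σ.rep (cls_eq (asIso f))).symm (congrArg σ.rep (cls_eq (asIso f)))
  simpa only [Representatives.iso, Iso.trans_inv, eqToIso.inv, Category.assoc] using h

variable (σ) in
/-- The functor `G : X ↦ [X]`, `(f : X ⟶ Y) ↦ (s, γ_{X_s}⁻¹(i_Y⁻¹ f i_X))` with `s = [X] = [Y]`. -/
def functorG : C ⥤ Reduction σ where
  obj X := ⟨cls X⟩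
  map f := mapG f
  map_id X := by
    apply (functorH σ).map_injective
    rw [functorH_map_mapG, Category.id_comp, Iso.hom_inv_id]
    exact ((functorH σ).map_id _).symm
  map_comp f g := by
    apply (functorH σ).map_injective
    rw [functorH_map_mapG, Functor.map_comp, functorH_map_mapG, functorH_map_mapG]
    simp

theorem functorH_map_functorG_map {X Y : C} (f : X ⟶ Y) :
    (functorH σ).map ((functorG σ).map f) = (σ.i X).hom ≫ f ≫ (σ.i Y).inv :=
  functorH_map_mapG f

variable (σ) in
/-- The isomorphism `G(i_X ⊗ i_Y) : [X][Y] ≅ [X ⊗ Y]`. -/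
def tensorIsoG (X Y : C) :
    (functorG σ).obj X ⊗ (functorG σ).obj Y ≅ (functorG σ).obj (X ⊗ Y) :=
  eqToIso (by
      change Reduction.mk (cls X * cls Y) = Reduction.mk (cls (σ.rep (cls X) ⊗ σ.rep (cls Y)))
      rw [cls_tensor, σ.cls_rep, σ.cls_rep]) ≪≫
    (functorG σ).mapIso (σ.i X ⊗ᵢ σ.i Y)

theorem functorH_map_tensorIsoG (X Y : C) :
    (functorH σ).map (tensorIsoG σ X Y).hom = (tensorIso σ (cls X) (cls Y)).inv ≫
      ((σ.i X).hom ⊗ₘ (σ.i Y).hom) ≫ (σ.i (X ⊗ Y)).inv := by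
  simp only [tensorIsoG, Iso.trans_hom, Functor.map_comp, Functor.mapIso_hom,
    functorH_map_functorG_map, eqToIso.hom, eqToHom_map, tensorIso, Iso.symm_inv,
    Representatives.iso, tensorIso_hom, Category.assoc]
  rfl

theorem functorH_map_whiskerRight {s t : Reduction σ} (f : s ⟶ t) (r : Reduction σ) :
    (functorH σ).map (f ▷ r) = (tensorIso σ s.toPi0 r.toPi0).inv ≫
      (functorH σ).map f ▷ σ.rep r.toPi0 ≫ (tensorIso σ t.toPi0 r.toPi0).hom :=
  (inducingData σ).whiskerRight_eq f r

theorem functorH_map_whiskerLeft (r : Reduction σ) {s t : Reduction σ} (f : s ⟶ t) :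
    (functorH σ).map (r ◁ f) = (tensorIso σ r.toPi0 s.toPi0).inv ≫
      σ.rep r.toPi0 ◁ (functorH σ).map f ≫ (tensorIso σ r.toPi0 t.toPi0).hom :=
  (inducingData σ).whiskerLeft_eq r f

theorem functorH_map_associator (s t r : Reduction σ) :
    (functorH σ).map (α_ s t r).hom =
      (tensorIso σ (s.toPi0 * t.toPi0) r.toPi0).inv ≫
      (tensorIso σ s.toPi0 t.toPi0).inv ▷ σ.rep r.toPi0 ≫
      (α_ (σ.rep s.toPi0) (σ.rep t.toPi0) (σ.rep r.toPi0)).hom ≫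
      σ.rep s.toPi0 ◁ (tensorIso σ t.toPi0 r.toPi0).hom ≫
      (tensorIso σ s.toPi0 (t.toPi0 * r.toPi0)).hom :=
  (fullyFaithfulH σ).map_preimage _

theorem functorH_map_leftUnitor (s : Reduction σ) :
    (functorH σ).map (λ_ s).hom = (tensorIso σ 1 s.toPi0).inv ≫
      (unitIso σ).inv ▷ σ.rep s.toPi0 ≫ (λ_ (σ.rep s.toPi0)).hom :=
  (fullyFaithfulH σ).map_preimage _

theorem functorH_map_rightUnitor (s : Reduction σ) :
    (functorH σ).map (ρ_ s).hom = (tensorIso σ s.toPi0 1).inv ≫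
      σ.rep s.toPi0 ◁ (unitIso σ).inv ≫ (ρ_ (σ.rep s.toPi0)).hom :=
  (fullyFaithfulH σ).map_preimage _

variable (σ) in
/-- The structure isomorphisms of `G`: they are `G(i_X ⊗ i_Y) : [X][Y] ⟶ [X ⊗ Y]` and the identity
of the class of the unit object. -/
def coreMonoidalG : (functorG σ).CoreMonoidal where
  εIso := Iso.refl _
  μIso := tensorIsoG σ
  μIso_hom_natural_left f Z := by
    apply (functorH σ).map_injective
    rw [Functor.map_comp, Functor.map_comp, functorH_map_whiskerRight, functorH_map_tensorIsoG,
      functorH_map_tensorIsoG, functorH_map_functorG_map, functorH_map_functorG_map]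
    exact auxNaturalLeft ..
  μIso_hom_natural_right Z f := by
    apply (functorH σ).map_injective
    rw [Functor.map_comp, Functor.map_comp, functorH_map_whiskerLeft, functorH_map_tensorIsoG,
      functorH_map_tensorIsoG, functorH_map_functorG_map, functorH_map_functorG_map]
    exact auxNaturalRight ..
  associativity X Y Z := by
    apply (functorH σ).map_injective
    simp only [Functor.map_comp]
    rw [functorH_map_whiskerRight, functorH_map_whiskerLeft, functorH_map_associator,
      functorH_map_tensorIsoG, functorH_map_tensorIsoG, functorH_map_tensorIsoG,
      functorH_map_tensorIsoG, functorH_map_functorG_map]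
    exact auxAssoc ..
  left_unitality X := by
    apply (functorH σ).map_injective
    simp only [Functor.map_comp]
    rw [functorH_map_whiskerRight, functorH_map_leftUnitor,
      functorH_map_tensorIsoG, functorH_map_functorG_map]
    rw [show (unitIso σ).inv = (σ.i (𝟙_ C)).hom from Category.id_comp _]
    exact auxLeftUnit (σ.i X) (σ.i (𝟙_ C)).symm (tensorIso σ 1 (cls X)) (σ.i (𝟙_ C ⊗ X))
      ((functorH σ).map (𝟙 (𝟙_ (Reduction σ)))) ((functorH σ).map_id _)
  right_unitality X := by
    apply (functorH σ).map_injective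
    simp only [Functor.map_comp]
    rw [functorH_map_whiskerLeft, functorH_map_rightUnitor,
      functorH_map_tensorIsoG, functorH_map_functorG_map]
    rw [show (unitIso σ).inv = (σ.i (𝟙_ C)).hom from Category.id_comp _]
    exact auxRightUnit (σ.i X) (σ.i (𝟙_ C)).symm (tensorIso σ (cls X) 1) (σ.i (X ⊗ 𝟙_ C))
      ((functorH σ).map (𝟙 (𝟙_ (Reduction σ)))) ((functorH σ).map_id _)

instance : (functorG σ).Monoidal := (coreMonoidalG σ).toMonoidal

variable (σ) in
/-- `G` and `H` are mutually inverse equivalences of categories, through the isomorphisms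
`i_X : HG(X) ≅ X` and the identity `GH(s) = s`. -/
def canonicalEquivalence : Reduction σ ≌ C :=
  .mk (functorH σ) (functorG σ)
    (NatIso.ofComponents
      (fun s => eqToIso (congrArg Reduction.mk (σ.cls_rep s.toPi0).symm)) (fun {s t} f => by
        apply (functorH σ).map_injective
        refine (Functor.map_comp _ _ _).trans (Eq.trans ?_ (Functor.map_comp _ _ _).symm)
        have h := functorH_map_functorG_map (σ := σ) ((functorH σ).map f)
        have hs := congrArg Iso.hom (σ.i_rep s.toPi0)
        have ht := congrArg Iso.inv (σ.i_rep t.toPi0)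
        refine Eq.trans ?_ (congrArg (_ ≫ ·) h.symm)
        have es := congrArg (Reduction.mk (σ := σ)) (σ.cls_rep s.toPi0).symm
        have et := congrArg (Reduction.mk (σ := σ)) (σ.cls_rep t.toPi0).symm
        exact auxEqToHom _ (congrArg (functorH σ).obj et) (congrArg (functorH σ).obj es)
          (congrArg (functorH σ).obj es.symm) (congrArg (functorH σ).obj et) _ _ _ _
          (eqToHom_map (functorH σ) et) (eqToHom_map (functorH σ) es) hs ht))
    (NatIso.ofComponents σ.i (fun f => by
      refine (congrArg (· ≫ (σ.i _).hom) (functorH_map_functorG_map f)).trans ?_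
      exact auxConj _ _ _))

instance : (functorG σ).IsEquivalence := (canonicalEquivalence σ).isEquivalence_inverse

instance : (functorH σ).IsEquivalence := (canonicalEquivalence σ).isEquivalence_functor

end Reduction

end Reduction

/-- A Gr-functor: a monoidal functor between Gr-categories. -/
structure GrFunctor (C : Type u₁) [Category.{v₁} C] [MonoidalCategory C] [GrCategory C]
    (D : Type u₂) [Category.{v₂} D] [MonoidalCategory D] [GrCategory D] where
  functor : C ⥤ D
  monoidal : functor.Monoidal

namespace GrFunctor

attribute [instance] monoidal

variable {C : Type u₁} [Category.{v₁} C] [MonoidalCategory C] [GrCategory C]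
variable {D : Type u₂} [Category.{v₂} D] [MonoidalCategory D] [GrCategory D]
variable {E : Type u₃} [Category.{v₃} E] [MonoidalCategory E] [GrCategory E]

/-- Composition of Gr-functors (first `F`, then `K`). -/
def comp (F : GrFunctor C D) (K : GrFunctor D E) : GrFunctor C E where
  functor := F.functor ⋙ K.functor
  monoidal := inferInstance

/-- The canonical equivalence `G` from a Gr-category to its reduction. -/
def toReduction (σ : Representatives C) : GrFunctor C (Reduction σ) where
  functor := Reduction.functorG σ
  monoidal := inferInstance

/-- The canonical equivalence `H` from the reduction of a Gr-category to the Gr-category. -/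
def ofReduction (σ : Representatives C) : GrFunctor (Reduction σ) C where
  functor := Reduction.functorH σ
  monoidal := inferInstance

/-- The map `F₀ : π₀ → π₀'`, `[X] ↦ [FX]`. -/
def pi0Map (F : GrFunctor C D) : Pi0 C → Pi0 D :=
  Quotient.map F.functor.obj (fun _ _ ⟨e⟩ => ⟨F.functor.mapIso e⟩)

/-- The map `F₁ : π₁ → π₁'`, `u ↦ γ_{FI}⁻¹(Fu)`. -/
def pi1Map (F : GrFunctor C D) (u : Pi1 C) : Pi1 D :=
  (gamma (F.functor.obj (𝟙_ C))).symm (F.functor.map u.hom)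

/-- `K : S ⥤ S'` is of type `(φ, f)`: the maps `φ` and `f` are group homomorphisms such that
`f(su) = φ(s)f(u)`, and `K(s) = φ(s)`, `K(s, u) = (φ(s), f(u))`. -/
structure IsOfType {σ : Representatives C} {τ : Representatives D}
    (K : Reduction σ ⥤ Reduction τ) (φ : Pi0 C → Pi0 D) (f : Pi1 C → Pi1 D) : Prop where
  map_mul : ∀ s t, φ (s * t) = φ s * φ t
  map_add : ∀ u v, f (u + v) = f u + f v
  map_smul : ∀ (s : Pi0 C) (u : Pi1 C), f (s • u) = φ s • f u
  obj_eq : ∀ s : Reduction σ, (K.obj s).toPi0 = φ s.toPi0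
  map_eq : ∀ {s t : Reduction σ} (a : s ⟶ t), (K.map a).val = f a.val

end GrFunctor

end GrCat

end

/-! The composite `G' F H` is itself the required functor, so its monoidal structure comes for free
and only its effect on objects and morphisms has to be computed. The key is that a monoidal functor
carries `γ_X(u)` to `γ_{FX}(F₁u)` and `δ_X(u)` to `δ_{FX}(F₁u)` (`map_gammaFun`, `map_delta`).

The formula for `γ` determines the functor: `H` sends `(s, u)` to `γ_{X_s}(u)`, `F` sends this to
`γ_{FX_s}(F₁u)`, and `G'` reads the label `F₁u` back off (`Reduction.mapG_gammaFun_val`), whatever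
representatives were chosen. Both formulas together give equivariance of `F₁`, since the action is
the comparison of `δ` with `γ`.

Both rest on naturality: `γ(u)` and `δ(u)` are natural endomorphisms of the identity functor, so
they slide past every structure isomorphism. -/

namespace GrCat

/-! ### `γ` and `δ` inside one Gr-category -/

section

variable {C : Type u₁} [Category.{v₁} C] [MonoidalCategory C]

/-- At `I` both maps return `u`, because the two unit constraints of `I` coincide; naturality
carries the equality along `e`. It is applied to `X = FI`, where `F₁` is defined through `γ` but the
computation of `F(δ_X(u))` produces `δ`. -/
theorem delta_eq_gammaFun_of_iso_unit {X : C} (e : 𝟙_ C ≅ X) (u : Pi1 C) :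
    delta X u = gammaFun X u := by
  rw [← cancel_epi e.hom, ← delta_natural, ← gammaFun_natural, delta_unit, gammaFun_unit]

variable [GrCategory C]

/-- By naturality, conjugating `γ_X(u)` with `i_X` gives `γ_{X_s}(u)`, which `γ_{X_s}⁻¹` sends back
to `u`. Hence the result does not depend on `σ`. -/
theorem Reduction.mapG_gammaFun_val {σ : Representatives C} (X : C) (u : Pi1 C) :
    (Reduction.mapG (σ := σ) (gammaFun X u)).val = u := by
  change (gamma (σ.rep (cls X))).symm _ = u
  rw [Equiv.symm_apply_eq, gamma_apply, gammaFun_conj (σ.i X).symm]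
  simp [Representatives.iso]

end

/-! ### The maps induced by a Gr-functor on `π₀` and `π₁` -/

namespace GrFunctor

variable {C : Type u₁} [Category.{v₁} C] [MonoidalCategory C] [GrCategory C]
variable {D : Type u₂} [Category.{v₂} D] [MonoidalCategory D] [GrCategory D]
variable (F : GrFunctor C D)

theorem pi0Map_cls (X : C) : F.pi0Map (cls X) = cls (F.functor.obj X) := rfl

theorem gammaFun_pi1Map (u : Pi1 C) :
    gammaFun (F.functor.obj (𝟙_ C)) (F.pi1Map u) = F.functor.map u.hom :=
  gammaFun_symm _ _

/-- A Gr-functor is compatible with `γ`. -/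
theorem map_gammaFun (X : C) (u : Pi1 C) :
    F.functor.map (gammaFun X u) = gammaFun (F.functor.obj X) (F.pi1Map u) := by
  -- Monoidality turns `F(u ⊗ id)` into `Fu ⊗ id` on `FI ⊗ FX`. As `Fu = γ_{FI}(F₁u)`, this is
  -- `γ_{FI ⊗ FX}(F₁u)`.
  have h : F.functor.map (gammaFun X u) = F.functor.map (λ_ X).inv ≫
      Functor.OplaxMonoidal.δ F.functor _ _ ≫ gammaFun _ (F.pi1Map u) ≫
        Functor.LaxMonoidal.μ F.functor _ _ ≫ F.functor.map (λ_ X).hom := by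
    rw [← gammaFun_whiskerRight, gammaFun_pi1Map]
    simp only [gammaFun, Functor.map_comp, Functor.Monoidal.map_whiskerRight, Category.assoc]
  -- Once `γ` has moved to the far end, the structure isomorphisms in front of it cancel in pairs;
  -- no unit coherence of `F` is needed.
  rw [h, gammaFun_natural (Functor.LaxMonoidal.μ F.functor (𝟙_ C) X ≫ F.functor.map (λ_ X).hom)]
  simp [← Functor.map_comp_assoc]

/-- A Gr-functor is compatible with `δ`. -/
theorem map_delta (X : C) (u : Pi1 C) :
    F.functor.map (delta X u) = delta (F.functor.obj X) (F.pi1Map u) := by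
  have h : F.functor.map (delta X u) = F.functor.map (ρ_ X).inv ≫
      Functor.OplaxMonoidal.δ F.functor _ _ ≫ delta _ (F.pi1Map u) ≫
        Functor.LaxMonoidal.μ F.functor _ _ ≫ F.functor.map (ρ_ X).hom := by
    -- On `FX ⊗ FI` it is `δ_{FI}(F₁u)` that appears. Since `FI ≅ I`, it equals `γ_{FI}(F₁u) = Fu`.
    rw [← whiskerLeft_delta, delta_eq_gammaFun_of_iso_unit (Functor.Monoidal.εIso F.functor),
      gammaFun_pi1Map]
    simp only [delta, Functor.map_comp, Functor.Monoidal.map_whiskerLeft, Category.assoc]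
  rw [h, delta_natural (Functor.LaxMonoidal.μ F.functor X (𝟙_ C) ≫ F.functor.map (ρ_ X).hom)]
  simp [← Functor.map_comp_assoc]

theorem pi0Map_mul (s t : Pi0 C) : F.pi0Map (s * t) = F.pi0Map s * F.pi0Map t := by
  induction s using Pi0.ind with | _ X
  induction t using Pi0.ind with | _ Y
  exact cls_eq (Functor.Monoidal.μIso F.functor X Y).symm

theorem pi1Map_add (u v : Pi1 C) : F.pi1Map (u + v) = F.pi1Map u + F.pi1Map v := by
  apply (gamma (F.functor.obj (𝟙_ C))).injective
  simp only [gamma_apply, gammaFun_add, gammaFun_pi1Map, Pi1.hom_add, Functor.map_comp]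

/-- Since `γ_{FX}` is injective, it suffices to compare images in the endomorphisms of `FX`, where
both sides become `F(δ_X(u))`. -/
theorem pi1Map_smul (s : Pi0 C) (u : Pi1 C) : F.pi1Map (s • u) = F.pi0Map s • F.pi1Map u := by
  induction s using Pi0.ind with | _ X
  apply (gamma (F.functor.obj X)).injective
  rw [gamma_apply, gamma_apply, ← map_gammaFun, gammaFun_smul, pi0Map_cls, gammaFun_smul,
    map_delta]

/-- The composite `G' F H` is of type `(F₀, F₁)`. -/
theorem isOfType_comp_canonicalEquivalences (σ : Representatives C) (τ : Representatives D) :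
    IsOfType (((ofReduction σ).comp F).comp (toReduction τ)).functor F.pi0Map F.pi1Map where
  map_mul := F.pi0Map_mul
  map_add := F.pi1Map_add
  map_smul := F.pi1Map_smul
  obj_eq s := by
    -- The left side is `[F X_s]`; writing `s` as `[X_s]` lets `F₀` compute to the same class.
    conv_rhs => rw [← σ.cls_rep s.toPi0]
    rfl
  map_eq := by
    rintro ⟨s⟩ ⟨t⟩ ⟨e, u⟩
    dsimp only at e
    -- With equal source and target, the transport in the definition of `H` on morphisms is an
    -- identity.
    subst e
    change (Reduction.mapG (σ := τ)
      (F.functor.map (gammaFun (σ.rep s) u ≫ eqToHom rfl))).val = F.pi1Map u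
    rw [eqToHom_refl, Category.comp_id, map_gammaFun, Reduction.mapG_gammaFun_val]

end GrFunctor

end GrCat

theorem proposition2p4
    {C : Type u₁} [Category.{v₁} C] [MonoidalCategory C] [GrCat.GrCategory C]
    {D : Type u₂} [Category.{v₂} D] [MonoidalCategory D] [GrCat.GrCategory D]
    (σ : GrCat.Representatives C) (τ : GrCat.Representatives D) (F : GrCat.GrFunctor C D) :
    ∃ S_F : GrCat.GrFunctor (GrCat.Reduction σ) (GrCat.Reduction τ),
      GrCat.GrFunctor.IsOfType S_F.functor F.pi0Map F.pi1Map ∧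
        S_F = ((GrCat.GrFunctor.ofReduction σ).comp F).comp (GrCat.GrFunctor.toReduction τ) := by
  -- The witness is the composite itself, so the equality of Gr-functors, monoidal structure
  -- included, is reflexivity.
  exact ⟨_, F.isOfType_comp_canonicalEquivalences σ τ, rfl⟩
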